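/- **Theorem (uniqueness for the inverse problem).** Fix $C_\Psi>0$ and a nonempty open interval $(\beta_0,\beta_1)\subset(0,1)$, and let $\Psi$ be the set of all $\mu\in C^1[0,1]$ with $\mu\ge 0$ on $[0,1]$, $\mu(1)\neq 0$ and $\mu\ge C_\Psi$ on $(\beta_0,\beta_1)$. For $\mu\in\Psi$ let $$D^{(\mu)}v(t)=\int_0^t\eta(t-\tau)\,v'(\tau)\,d\tau,\qquad \eta(s)=\int_0^1\frac{\mu(\alpha)}{\Gamma(1-\alpha)}\,s^{-\alpha}\,d\alpha ,$$ be the distributed-order Djrbashian--Caputo derivative. Let $g_0\in L^2(0,\infty)$ be real-valued with Laplace transform $(\mathcal L g_0)(z)=\int_0^\infty e^{-zt}g_0(t)\,dt\neq0$ for all $z\in(0,\infty)$. Consider $$D^{(\mu)}u-u_{xx}=0\ \ (0<x<1,\ t>0),\qquad u(x,0)=0,\qquad u(0,t)=g_0(t),\qquad u(1,t)=0 .$$ A weak solution is a function $u$ such that: $u$ and $u_x$ (one-sided at $x=1$) exist and are continuous on $(0,1]\times(0,\infty)$, and $x\mapsto u(x,\cdot)$, $x\mapsto u_x(x,\cdot)$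 are continuous from $(0,1]$ to $L^2(0,\infty)$; $u(x,0)=0$ for $0<x<1$; $u(x,\cdot)\to g_0$ in $L^2(0,\infty)$ as $x\to0^+$; $u(1,t)=0$ for $t>0$; and for every $\psi\in C_c^\infty(0,1)$ the function $t\mapsto\int_0^1u(x,t)\psi(x)\,dx$ is absolutely continuous on every $[0,T]$ and satisfies $D^{(\mu)}\big(\int_0^1u(x,\cdot)\psi(x)\,dx\big)(t)=\int_0^1u(x,t)\psi''(x)\,dx$ for almost every $t>0$. Let $\mu_1,\mu_2\in\Psi$ and let $u(x,t;\mu_1)$, $u(x,t;\mu_2)$ be weak solutions for $\mu_1$ and $\mu_2$ respectively, with the same $g_0$. Let $x_0\in(0,1)$ and $x^\star\in(0,1]$. If either $$u(x_0,t;\mu_1)=u(x_0,t;\mu_2)\ \text{ for all } t\in(0,\infty),\qquad\text{or}\qquad \frac{\partial u}{\partial x}(x^\star,t;\mu_1)=\frac{\partial u}{\partial x}(x^\star,t;\mu_2)\ \text{ for all } t\in(0,\infty),$$ then $\mu_1=\mu_2$ on $[0,1]$. -/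

import Mathlib

open Set Filter Topology MeasureTheory
open scoped ContDiff

noncomputable section

/-- The kernel `η(s) = ∫₀¹ μ(α) / Γ(1 - α) · s^(-α) dα` of the distributed-order derivative.
(At the single point `α = 1` the integrand takes the value `0`, which is `1 / Γ(0)`.) -/
def distKernel (μ : ℝ → ℝ) (s : ℝ) : ℝ :=
  ∫ α in (0 : ℝ)..1, μ α / Real.Gamma (1 - α) * s ^ (-α)

/-- The distributed-order Djrbashian-Caputo derivative
`D^(μ) v (t) = ∫₀ᵗ η(t - τ) v'(τ) dτ`; it is applied to absolutely continuous `v` only. -/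
def distDeriv (μ : ℝ → ℝ) (v : ℝ → ℝ) (t : ℝ) : ℝ :=
  ∫ τ in (0 : ℝ)..t, distKernel μ (t - τ) * deriv v τ

/-- The admissible class `Ψ`, with constant `C` and interval `(b₀, b₁)`. -/
def admissibleClass (C b₀ b₁ : ℝ) : Set (ℝ → ℝ) :=
  {μ | ContDiffOn ℝ 1 μ (Icc 0 1) ∧ (∀ α ∈ Icc (0 : ℝ) 1, 0 ≤ μ α) ∧ μ 1 ≠ 0 ∧
    ∀ α ∈ Ioo b₀ b₁, C ≤ μ α}

/-- The Laplace transform `(ℒ g)(z) = ∫₀^∞ e^(-zt) g(t) dt` at a real point `z`. -/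
def laplaceTransform (g : ℝ → ℝ) (z : ℝ) : ℝ :=
  ∫ t in Ioi (0 : ℝ), Real.exp (-(z * t)) * g t

/-- Lebesgue measure on the time axis `(0, ∞)`. -/
def timeMeasure : Measure ℝ := volume.restrict (Ioi 0)

/-- `v ∈ C(S; L²(0, ∞))`: every `v x`, `x ∈ S`, is square integrable on `(0, ∞)` and
`x ↦ v x` is continuous on `S` for the norm of `L²(0, ∞)`. -/
def ContinuousIntoL2 (v : ℝ → ℝ → ℝ) (S : Set ℝ) : Prop :=
  (∀ x ∈ S, MemLp (v x) 2 timeMeasure) ∧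
  ∀ x ∈ S, Tendsto (fun y => eLpNorm (fun t => v y t - v x t) 2 timeMeasure) (𝓝[S] x) (𝓝 0)

/-- The flux `u_x(x, t)`; at the right end point `x = 1` it is the one-sided derivative. -/
def flux (u : ℝ → ℝ → ℝ) (x t : ℝ) : ℝ :=
  derivWithin (fun y => u y t) (Ioc 0 1) x

/-- Test functions: smooth functions with compact support in `(0, 1)`. -/
def IsTestFunction (ψ : ℝ → ℝ) : Prop :=
  ContDiff ℝ ∞ ψ ∧ HasCompactSupport ψ ∧ tsupport ψ ⊆ Ioo 0 1

/-- `u = u(x, t)` is the weak solution of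
`D^(μ) u - u_xx = 0` on `(0, 1) × (0, ∞)`, `u(x, 0) = 0`, `u(0, t) = g(t)`, `u(1, t) = 0`,
where `g ∈ L²(0, ∞)`. -/
structure IsWeakSolution (μ : ℝ → ℝ) (g : ℝ → ℝ) (u : ℝ → ℝ → ℝ) : Prop where
  /-- Up to `x = 1` and away from `x = 0`, the functions `u` and `u_x` are continuous, so that
  their values at a given point are meaningful. -/
  continuousOn : ContinuousOn (Function.uncurry u) (Ioc 0 1 ×ˢ Ioi 0)
  differentiableOn : ∀ t > 0, DifferentiableOn ℝ (fun x => u x t) (Ioc 0 1)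
  continuousOn_flux : ContinuousOn (Function.uncurry (flux u)) (Ioc 0 1 ×ˢ Ioi 0)
  /-- Both are continuous in `x` with values in `L²(0, ∞)`. -/
  continuousIntoL2 : ContinuousIntoL2 u (Ioc 0 1)
  continuousIntoL2_flux : ContinuousIntoL2 (flux u) (Ioc 0 1)
  /-- Initial condition. -/
  initial : ∀ x ∈ Ioo (0 : ℝ) 1, u x 0 = 0
  /-- Left boundary condition, for `L²` data: `u(x, ·) → g` in `L²(0, ∞)` as `x → 0+`. -/
  left : Tendsto (fun x => eLpNorm (fun t => u x t - g t) 2 timeMeasure) (𝓝[>] 0) (𝓝 0)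
  /-- Right boundary condition. -/
  right : ∀ t > 0, u 1 t = 0
  /-- For every test function `ψ` the function `t ↦ ⟨u(·, t), ψ⟩` is absolutely continuous on
  every `[0, T]`. -/
  absolutelyContinuous : ∀ ψ, IsTestFunction ψ → ∀ T > 0,
    AbsolutelyContinuousOnInterval (fun t => ∫ x in (0 : ℝ)..1, u x t * ψ x) 0 T
  /-- The equation `D^(μ) ⟨u(·, t), ψ⟩ = ⟨u(·, t), ψ''⟩` for every test function `ψ`. -/
  equation : ∀ ψ, IsTestFunction ψ → ∀ᵐ t ∂timeMeasure,
    distDeriv μ (fun s => ∫ x in (0 : ℝ)..1, u x s * ψ x) t =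
      ∫ x in (0 : ℝ)..1, u x t * deriv (deriv ψ) x

end

/-!
The proof passes to the Laplace transform in time at real points `z > 0`. The kernel `η` has the
transform `Φ(z) / z` with the symbol `Φ(z) = ∫₀¹ μ(α) z^α dα` (`laplaceTransform_distKernel`), by
Tonelli and the Gamma integral. For an absolutely continuous `v` with `v(0) = 0` the derivative `v'`
may grow too fast to have a Laplace transform, but integrating `D^(μ) v = w` in time gives
`1 * w = η * v` (convolutions on `(0, t)`), where only `v` and `w` have to be transformed;
hence `ℒ w = Φ ℒ v` (`laplaceTransform_of_distDeriv_eq`).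

Consequently `U(x) = ℒ u(x, ·)(z)` is a weak solution of `U'' = Φ(z) U` on `(0, 1)`. It is of class
`C¹` with derivative `ℒ u_x(x, ·)(z)`, so the lemma of du Bois-Reymond makes it a classical
solution. Since it tends to `ℒ g(z)` at `0` and vanishes at `1`, with `k = √Φ(z)` it equals
`ℒ g(z) sinh(k(1 - x)) / sinh k` (`eq_sinh_of_weak_ode`,
`IsWeakSolution.laplaceTransform_eq`).

As `ℒ g(z) ≠ 0`, the data determine `sinh(k(1 - x₀)) / sinh k` in the first case and
`k cosh(k(1 - x⋆)) / sinh k` in the second. The latter is not injective in `k > 0` in general, but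
both are strictly decreasing for large `k`. The lower bound on `μ` forces `Φ(z) → ∞`
(`tendsto_distSymbol_atTop`), so the two symbols agree for all large `z`. Sampling them at
`z = exp(s + n)`, `n ∈ ℕ`, shows that `(μ₁ - μ₂) exp(s α)` is orthogonal to all polynomials in
`exp α`, and the Weierstrass approximation theorem gives `μ₁ = μ₂` (`eqOn_of_distSymbol_eq`).
-/

/-! ### Test functions and the lemma of du Bois-Reymond -/

theorem isTestFunction_deriv {ψ : ℝ → ℝ} (hψ : IsTestFunction ψ) : IsTestFunction (deriv ψ) :=
  ⟨(contDiff_infty_iff_deriv.1 hψ.1).2, hψ.2.1.deriv,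
    (closure_minimal support_deriv_subset (isClosed_tsupport ψ)).trans hψ.2.2⟩

theorem IsTestFunction.eq_zero {ψ : ℝ → ℝ} (hψ : IsTestFunction ψ) {x : ℝ}
    (hx : x ∉ Ioo (0 : ℝ) 1) :
    ψ x = 0 :=
  image_eq_zero_of_notMem_tsupport fun h => hx (hψ.2.2 h)

theorem IsTestFunction.continuous_mul {ψ h : ℝ → ℝ} (hψ : IsTestFunction ψ)
    (hh : ContinuousOn h (Ioo 0 1)) : Continuous fun x => h x * ψ x :=
  (hh.mul hψ.1.continuous.continuousOn).continuous_of_tsupport_subset isOpen_Ioo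
    (tsupport_mul_subset_right.trans hψ.2.2)

theorem IsTestFunction.exists_tsupport_subset_Ioo {ψ : ℝ → ℝ} (hψ : IsTestFunction ψ) :
    ∃ a b : ℝ, 0 < a ∧ a ≤ b ∧ b < 1 ∧ tsupport ψ ⊆ Ioo a b := by
  have hK : IsCompact (tsupport ψ) := hψ.2.1
  rcases (tsupport ψ).eq_empty_or_nonempty with he | hne
  · exact ⟨1 / 2, 1 / 2, by norm_num, le_rfl, by norm_num, by simp [he]⟩
  have ha := hψ.2.2 (hK.sInf_mem hne)
  have hb := hψ.2.2 (hK.sSup_mem hne)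
  refine ⟨sInf (tsupport ψ) / 2, (sSup (tsupport ψ) + 1) / 2, by linarith [ha.1],
    by linarith [ha.2, hb.1, ha.1, csInf_le hK.bddBelow (hK.sSup_mem hne)], by linarith [hb.2],
    fun x hx => ?_⟩
  have h1 := csInf_le hK.bddBelow hx
  have h2 := le_csSup hK.bddAbove hx
  constructor <;> linarith [ha.1, hb.2]

/-- The antiderivative of a test function of mean zero is a test function. -/
theorem IsTestFunction.exists_deriv_eq {φ : ℝ → ℝ} (hφ : IsTestFunction φ)
    (h0 : ∫ x in (0 : ℝ)..1, φ x = 0) : ∃ ψ, IsTestFunction ψ ∧ deriv ψ = φ := by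
  have hc := hφ.1.continuous
  obtain ⟨a, b, ha, hab, hb, hKab⟩ := hφ.exists_tsupport_subset_Ioo
  have hz : ∀ x, x ∉ Icc a b → φ x = 0 := fun x hx =>
    image_eq_zero_of_notMem_tsupport fun h => hx (Ioo_subset_Icc_self (hKab h))
  have hd : ∀ x, HasDerivAt (fun x => ∫ y in (0 : ℝ)..x, φ y) (φ x) x := fun x =>
    (hc.integral_hasStrictDerivAt 0 x).hasDerivAt
  have hde : deriv (fun x => ∫ y in (0 : ℝ)..x, φ y) = φ := funext fun x => (hd x).deriv
  have hs : tsupport (fun x => ∫ y in (0 : ℝ)..x, φ y) ⊆ Icc a b := by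
    refine closure_minimal (fun x hx => ?_) isClosed_Icc
    by_contra hxab
    apply hx
    rcases lt_or_ge x a with h | h
    · refine intervalIntegral.integral_zero_ae (ae_of_all _ fun y hy => hz y fun hy' => ?_)
      have h1 := hy'.1
      have : y ≤ max 0 x := hy.2
      have := max_lt ha h
      linarith
    · have hbx : b < x := lt_of_not_ge fun h' => hxab ⟨h, h'⟩
      have : ∫ y in x..1, φ y = 0 := by
        refine intervalIntegral.integral_zero_ae (ae_of_all _ fun y hy => hz y fun hy' => ?_)
        have h1 := hy'.2
        have : min x 1 < y := hy.1
        have := lt_min hbx hb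
        linarith
      have h2 := intervalIntegral.integral_add_adjacent_intervals
        (hc.intervalIntegrable 0 x) (hc.intervalIntegrable (μ := volume) x 1)
      change ∫ y in (0 : ℝ)..x, φ y = 0
      linarith
  refine ⟨fun x => ∫ y in (0 : ℝ)..x, φ y, ⟨?_, ?_, ?_⟩, hde⟩
  · rw [contDiff_infty_iff_deriv, hde]
    exact ⟨fun x => (hd x).differentiableAt, hφ.1⟩
  · exact isCompact_Icc.of_isClosed_subset (isClosed_tsupport _) hs
  · exact hs.trans fun x hx => ⟨ha.trans_le hx.1, hx.2.trans_lt hb⟩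

theorem exists_isTestFunction_integral_eq_one :
    ∃ φ, IsTestFunction φ ∧ ∫ x in (0 : ℝ)..1, φ x = 1 := by
  let f : ContDiffBump (1 / 2 : ℝ) := ⟨1 / 8, 1 / 4, by norm_num, by norm_num⟩
  have hs : tsupport (f.normed volume) ⊆ Ioo 0 1 := by
    rw [f.tsupport_normed_eq]
    intro x hx
    rw [Real.closedBall_eq_Icc] at hx
    have h1 := hx.1
    have h2 := hx.2
    simp only [f] at h1 h2
    constructor <;> linarith
  refine ⟨f.normed volume, ⟨f.contDiff_normed, f.hasCompactSupport_normed, hs⟩, ?_⟩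
  rw [intervalIntegral.integral_eq_integral_of_support_subset, f.integral_normed]
  exact (subset_tsupport _).trans (hs.trans Ioo_subset_Ioc_self)

/-- Lemma of du Bois-Reymond: a continuous function with vanishing weak derivative is constant. -/
theorem exists_eq_const_of_integral_mul_deriv_eq_zero {h : ℝ → ℝ} (hh : ContinuousOn h (Ioo 0 1))
    (H : ∀ ψ, IsTestFunction ψ → ∫ x in (0 : ℝ)..1, h x * deriv ψ x = 0) :
    ∃ c, ∀ x ∈ Ioo (0 : ℝ) 1, h x = c := by
  obtain ⟨φ₀, hφ₀, hφ₀1⟩ := exists_isTestFunction_integral_eq_one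
  set c := ∫ x in (0 : ℝ)..1, h x * φ₀ x with hcdef
  refine ⟨c, ?_⟩
  have key : ∀ φ, IsTestFunction φ → ∫ x in (0 : ℝ)..1, (h x - c) * φ x = 0 := by
    intro φ hφ
    -- `φ - m φ₀` has mean zero, so it is the derivative of a test function.
    set m := ∫ x in (0 : ℝ)..1, φ x with hm
    have hφc := hφ.1.continuous
    have hφ₀c := hφ₀.1.continuous
    have ht : IsTestFunction (fun x => φ x - m * φ₀ x) := by
      refine ⟨hφ.1.sub (contDiff_const.mul hφ₀.1), ?_, ?_⟩
      · exact hφ.2.1.sub (hφ₀.2.1.mul_left (f := fun _ => m))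
      · exact (tsupport_sub _ _).trans
          (union_subset hφ.2.2 (tsupport_mul_subset_right.trans hφ₀.2.2))
    obtain ⟨ψ, hψ, hψd⟩ := ht.exists_deriv_eq (by
      rw [intervalIntegral.integral_sub (hφc.intervalIntegrable _ _)
        ((hφ₀c.const_mul m).intervalIntegrable _ _), intervalIntegral.integral_const_mul, hφ₀1]
      simp [hm])
    have h1 := H ψ hψ
    rw [hψd] at h1
    have i1 := (hφ.continuous_mul hh).intervalIntegrable (μ := volume) 0 1
    have i2 := (hφ₀.continuous_mul hh).intervalIntegrable (μ := volume) 0 1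
    have e1 : ∀ x, h x * (φ x - m * φ₀ x) = h x * φ x - m * (h x * φ₀ x) := fun x => by ring
    simp_rw [e1] at h1
    rw [intervalIntegral.integral_sub i1 (i2.const_mul m), intervalIntegral.integral_const_mul]
      at h1
    simp_rw [sub_mul]
    rw [intervalIntegral.integral_sub i1 ((hφc.intervalIntegrable _ _).const_mul c),
      intervalIntegral.integral_const_mul]
    linarith
  have hcont : ContinuousOn (fun x => h x - c) (Ioo 0 1) := hh.sub continuousOn_const
  have hae := isOpen_Ioo.ae_eq_zero_of_integral_contDiff_smul_eq_zero
    (hcont.locallyIntegrableOn (μ := volume) measurableSet_Ioo) (fun φ h1 h2 h3 => by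
      rw [← key φ ⟨h1, h2, h3⟩, intervalIntegral.integral_eq_integral_of_support_subset]
      · exact integral_congr_ae (ae_of_all _ fun x => mul_comm _ _)
      · intro x hx
        exact Ioo_subset_Ioc_self (h3 (subset_tsupport _ (right_ne_zero_of_mul hx))))
  have := Measure.eqOn_open_of_ae_eq (μ := volume) (f := fun x => h x - c) (g := fun _ => 0)
    ((ae_restrict_iff' measurableSet_Ioo).2 hae) isOpen_Ioo hcont continuousOn_const
  exact fun x hx => sub_eq_zero.1 (this hx)

theorem IsTestFunction.integral_mul_deriv {U V ψ : ℝ → ℝ} (hψ : IsTestFunction ψ)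
    (hU : ∀ x ∈ Ioo (0 : ℝ) 1, HasDerivAt U (V x) x) (hV : ContinuousOn V (Ioo 0 1)) :
    ∫ x in (0 : ℝ)..1, U x * deriv ψ x = -∫ x in (0 : ℝ)..1, V x * ψ x := by
  have hUc : ContinuousOn U (Ioo 0 1) := fun x hx => (hU x hx).continuousAt.continuousWithinAt
  have c1 := hψ.continuous_mul hV
  have c2 := (isTestFunction_deriv hψ).continuous_mul hUc
  have hd : ∀ x, HasDerivAt (fun x => U x * ψ x) (V x * ψ x + U x * deriv ψ x) x := by
    intro x
    by_cases hx : x ∈ tsupport ψ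
    · exact (hU x (hψ.2.2 hx)).mul (hψ.1.differentiable (by simp) x).hasDerivAt
    · have hev : ∀ᶠ y in 𝓝 x, y ∉ tsupport ψ :=
        (isClosed_tsupport ψ).isOpen_compl.mem_nhds hx
      have h0 : (fun x => U x * ψ x) =ᶠ[𝓝 x] fun _ => 0 :=
        hev.mono fun y hy => by simp [image_eq_zero_of_notMem_tsupport hy]
      have hd0 : deriv ψ x = 0 := by
        by_contra hne
        exact hx (support_deriv_subset hne)
      rw [image_eq_zero_of_notMem_tsupport hx, hd0, mul_zero, mul_zero, add_zero]
      exact (hasDerivAt_const x (0 : ℝ)).congr_of_eventuallyEq h0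
  have hFTC := intervalIntegral.integral_eq_sub_of_hasDerivAt (a := 0) (b := 1)
    (fun x _ => hd x) ((c1.add c2).intervalIntegrable _ _)
  rw [intervalIntegral.integral_add (c1.intervalIntegrable _ _) (c2.intervalIntegrable _ _),
    hψ.eq_zero (by simp), hψ.eq_zero (by simp)] at hFTC
  linarith

/-! ### The boundary value problem `U'' = k² U` on `(0, 1)` -/

/-- A weak solution of `U'' = k² U` that is of class `C¹` solves the equation classically. -/
theorem hasDerivAt_of_weak_ode {U V : ℝ → ℝ} {k : ℝ}
    (hU : ∀ x ∈ Ioo (0 : ℝ) 1, HasDerivAt U (V x) x) (hV : ContinuousOn V (Ioo 0 1))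
    (hode : ∀ ψ, IsTestFunction ψ →
      ∫ x in (0 : ℝ)..1, U x * deriv (deriv ψ) x = k ^ 2 * ∫ x in (0 : ℝ)..1, U x * ψ x) :
    ∀ x ∈ Ioo (0 : ℝ) 1, HasDerivAt V (k ^ 2 * U x) x := by
  have hUc : ContinuousOn U (Ioo 0 1) := fun x hx => (hU x hx).continuousAt.continuousWithinAt
  set W : ℝ → ℝ := fun x => ∫ y in (1 / 2 : ℝ)..x, U y
  have hW : ∀ x ∈ Ioo (0 : ℝ) 1, HasDerivAt W (U x) x := by
    intro x hx
    refine intervalIntegral.integral_hasDerivAt_right ?_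
      (hUc.stronglyMeasurableAtFilter isOpen_Ioo x hx) (hUc.continuousAt (isOpen_Ioo.mem_nhds hx))
    refine (hUc.mono ?_).intervalIntegrable
    exact ordConnected_Ioo.uIcc_subset (by norm_num) hx
  have hWc : ContinuousOn W (Ioo 0 1) := fun x hx => (hW x hx).continuousAt.continuousWithinAt
  obtain ⟨c, hc⟩ := exists_eq_const_of_integral_mul_deriv_eq_zero
    (h := fun x => V x - k ^ 2 * W x) (hV.sub (hWc.const_mul _)) (by
      intro ψ hψ
      have h1 := (isTestFunction_deriv hψ).integral_mul_deriv hU hV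
      have h2 := hψ.integral_mul_deriv hW hUc
      have h3 := hode ψ hψ
      have e : ∀ x, (V x - k ^ 2 * W x) * deriv ψ x
          = V x * deriv ψ x - k ^ 2 * (W x * deriv ψ x) := fun x => by ring
      simp_rw [e]
      rw [intervalIntegral.integral_sub
        (((isTestFunction_deriv hψ).continuous_mul hV).intervalIntegrable _ _)
        ((((isTestFunction_deriv hψ).continuous_mul hWc).intervalIntegrable _ _).const_mul _),
        intervalIntegral.integral_const_mul]
      linear_combination h1 - k ^ 2 * h2 - h3)
  intro x hx
  have : V =ᶠ[𝓝 x] fun x => k ^ 2 * W x + c := by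
    filter_upwards [isOpen_Ioo.mem_nhds hx] with y hy
    have := hc y hy
    linarith
  exact (((hW x hx).const_mul _).add_const c).congr_of_eventuallyEq this

/-- The `C¹` solution of `U'' = k² U`, `U(0+) = G`, `U(1) = 0`, together with its derivative. -/
theorem eq_sinh_of_weak_ode {U V : ℝ → ℝ} {k G : ℝ} (hk : 0 < k)
    (hU : ∀ x ∈ Ioo (0 : ℝ) 1, HasDerivAt U (V x) x)
    (hUc : ContinuousOn U (Ioc 0 1)) (hV : ContinuousOn V (Ioc 0 1))
    (hode : ∀ ψ, IsTestFunction ψ →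
      ∫ x in (0 : ℝ)..1, U x * deriv (deriv ψ) x = k ^ 2 * ∫ x in (0 : ℝ)..1, U x * ψ x)
    (h0 : Tendsto U (𝓝[>] 0) (𝓝 G)) (h1 : U 1 = 0) {x : ℝ} (hx : x ∈ Ioc (0 : ℝ) 1) :
    U x = G * (Real.sinh (k * (1 - x)) / Real.sinh k) ∧
      V x = -(G * (k * Real.cosh (k * (1 - x)) / Real.sinh k)) := by
  have hVd := hasDerivAt_of_weak_ode hU (hV.mono Ioo_subset_Ioc_self) hode
  -- `V + s U` times `exp (-s x)` is a first integral for either square root `s` of `k²`.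
  have key : ∀ s : ℝ, s ^ 2 = k ^ 2 →
      ∃ A, ∀ x ∈ Ioc (0 : ℝ) 1, V x + s * U x = A * Real.exp (s * x) := by
    intro s hs
    have hF : ∀ x ∈ Ioo (0 : ℝ) 1,
        HasDerivAt (fun x => (V x + s * U x) * Real.exp (-(s * x))) 0 x := by
      intro x hx
      have e := (((hasDerivAt_id x).const_mul s).neg).exp
      have := ((hVd x hx).add ((hU x hx).const_mul s)).mul e
      refine this.congr_deriv ?_
      simp only [id, Pi.add_apply, Pi.neg_apply]
      linear_combination -(U x) * Real.exp (-(s * x)) * hs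
    obtain ⟨A, hA⟩ := isOpen_Ioo.exists_is_const_of_deriv_eq_zero isPreconnected_Ioo
      (fun x hx => (hF x hx).differentiableAt.differentiableWithinAt)
      (fun x hx => (hF x hx).deriv)
    refine ⟨A, ?_⟩
    have hcl : EqOn (fun x => (V x + s * U x) * Real.exp (-(s * x))) (fun _ => A) (Ioc 0 1) := by
      refine EqOn.of_subset_closure (s := Ioo 0 1) hA ?_ continuousOn_const Ioo_subset_Ioc_self ?_
      · exact (hV.add (hUc.const_mul s)).mul (by fun_prop)
      · rw [closure_Ioo (by norm_num)]
        exact Ioc_subset_Icc_self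
    intro x hx
    have := hcl hx
    simp only at this
    rw [← this, mul_assoc, ← Real.exp_add]
    simp
  obtain ⟨A, hA⟩ := key k rfl
  obtain ⟨B, hB⟩ := key (-k) (by ring)
  have hUx : ∀ x ∈ Ioc (0 : ℝ) 1,
      2 * k * U x = A * Real.exp (k * x) - B * Real.exp (-k * x) := by
    intro x hx
    linear_combination hA x hx - hB x hx
  have hAB : 2 * k * G = A - B := by
    have t1 : Tendsto (fun x => 2 * k * U x) (𝓝[>] 0) (𝓝 (2 * k * G)) := h0.const_mul _
    have t2 : Tendsto (fun x => A * Real.exp (k * x) - B * Real.exp (-k * x)) (𝓝[>] 0)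
        (𝓝 (A - B)) := by
      have : Continuous fun x => A * Real.exp (k * x) - B * Real.exp (-k * x) := by fun_prop
      have := this.tendsto 0
      simp only [mul_zero, Real.exp_zero, mul_one] at this
      exact this.mono_left nhdsWithin_le_nhds
    refine tendsto_nhds_unique t1 (t2.congr' ?_)
    filter_upwards [Ioc_mem_nhdsGT (zero_lt_one' ℝ)] with x hx
    exact (hUx x hx).symm
  have hAB1 : A * Real.exp k = B * Real.exp (-k) := by
    have := hUx 1 (by simp)
    rw [h1] at this
    simp only [mul_one] at this
    linarith
  have hsk : 0 < Real.sinh k := Real.sinh_pos_iff.2 hk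
  have hsE : Real.exp k - Real.exp (-k) = 2 * Real.sinh k := by rw [Real.sinh_eq]; ring
  have hA' : A * Real.sinh k = -k * G * Real.exp (-k) := by
    have hee : Real.exp k * Real.exp (-k) = 1 := by rw [← Real.exp_add]; simp
    linear_combination (-A/2) * hsE + hAB1 / 2 + Real.exp (-k) * hAB / 2
  have hB' : B * Real.sinh k = -k * G * Real.exp k := by
    linear_combination (-B/2) * hsE + hAB1 / 2 + Real.exp k * hAB / 2
  have e1 : Real.exp (k * (1 - x)) = Real.exp k * Real.exp (-k * x) := by
    rw [← Real.exp_add]; ring_nf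
  have e2 : Real.exp (-(k * (1 - x))) = Real.exp (-k) * Real.exp (k * x) := by
    rw [← Real.exp_add]; ring_nf
  constructor
  · rw [← mul_div_assoc, eq_div_iff hsk.ne', Real.sinh_eq (k * (1 - x)), e1, e2]
    have h2 := hUx x hx
    have : k * (U x * Real.sinh k
        - G * ((Real.exp k * Real.exp (-k * x) - Real.exp (-k) * Real.exp (k * x)) / 2)) = 0 := by
      linear_combination Real.sinh k / 2 * h2 + Real.exp (k * x) / 2 * hA'
        - Real.exp (-k * x) / 2 * hB'
    rcases mul_eq_zero.1 this with h | h
    · exact absurd h hk.ne'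
    · linarith
  · rw [← mul_div_assoc, ← neg_div, eq_div_iff hsk.ne', Real.cosh_eq (k * (1 - x)), e1, e2]
    have h2 := hA x hx
    have h3 := hB x hx
    linear_combination Real.sinh k / 2 * (h2 + h3) + Real.exp (k * x) / 2 * hA'
        + Real.exp (-k * x) / 2 * hB'

/-! ### Injectivity of the boundary observations for large `k` -/

theorem strictAntiOn_Ici_of_hasDerivAt_neg {f f' : ℝ → ℝ} {K : ℝ}
    (hf : ∀ k ≥ K, HasDerivAt f (f' k) k) (hf' : ∀ k ≥ K, f' k < 0) : StrictAntiOn f (Ici K) := by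
  refine strictAntiOn_of_deriv_neg (convex_Ici K)
    (fun k hk => (hf k hk).continuousAt.continuousWithinAt) fun k hk => ?_
  rw [interior_Ici] at hk
  rw [(hf k hk.le).deriv]
  exact hf' k hk.le

/-- The value at distance `y` from the right end point, as a function of `k`, is eventually
strictly decreasing. -/
theorem exists_strictAntiOn_sinh_div_sinh {y : ℝ} (hy : y ∈ Ioo (0 : ℝ) 1) :
    ∃ K, StrictAntiOn (fun k => Real.sinh (k * y) / Real.sinh k) (Ici K) := by
  obtain ⟨hy0, hy1⟩ := hy
  have hy1' : 0 < 1 - y := by linarith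
  refine ⟨1 / (y * (1 - y)), strictAntiOn_Ici_of_hasDerivAt_neg (f' := fun k =>
    (Real.cosh (k * y) * y * Real.sinh k - Real.sinh (k * y) * Real.cosh k) / Real.sinh k ^ 2)
    ?_ ?_⟩
  all_goals
    intro k hk
    have hk0 : 0 < k := lt_of_lt_of_le (by positivity) hk
    have hs : 0 < Real.sinh k := Real.sinh_pos_iff.2 hk0
  · have h1 : HasDerivAt (fun k : ℝ => k * y) y k := by
      simpa using (hasDerivAt_id k).mul_const y
    exact (h1.sinh).div (Real.hasDerivAt_sinh k) hs.ne'
  · refine div_neg_of_neg_of_pos ?_ (by positivity)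
    have hsc : Real.sinh k < Real.cosh k := Real.sinh_lt_cosh k
    have hc : 0 < Real.cosh (k * y) := Real.cosh_pos _
    -- `(1 - y) cosh (k y) ≥ exp (-k y)` because `exp (2 k y) ≥ 1 + 2 k y ≥ 2 / (1 - y)`.
    have hky : 1 ≤ k * y * (1 - y) := by
      rw [ge_iff_le, div_le_iff₀ (by positivity)] at hk
      linarith
    have hmain : y * Real.cosh (k * y) ≤ Real.sinh (k * y) := by
      have e1 : k * y + k * y + 1 ≤ Real.exp (k * y + k * y) := Real.add_one_le_exp _
      have e2 : Real.exp (k * y + k * y) * Real.exp (-(k * y)) = Real.exp (k * y) := by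
        rw [← Real.exp_add]; ring_nf
      have e3 := Real.exp_pos (-(k * y))
      rw [Real.cosh_eq, Real.sinh_eq]
      have e4 : 2 ≤ Real.exp (k * y + k * y) * (1 - y) := by nlinarith
      rw [← e2]
      nlinarith [mul_le_mul_of_nonneg_right e4 e3.le]
    have hs0 : 0 < Real.sinh (k * y) := Real.sinh_pos_iff.2 (by positivity)
    calc Real.cosh (k * y) * y * Real.sinh k - Real.sinh (k * y) * Real.cosh k
        ≤ Real.sinh (k * y) * Real.sinh k - Real.sinh (k * y) * Real.cosh k := by
          have := mul_le_mul_of_nonneg_right hmain hs.le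
          linarith
      _ < 0 := by nlinarith

/-- The flux at distance `y` from the right end point, as a function of `k`, is eventually
strictly decreasing. -/
theorem exists_strictAntiOn_mul_cosh_div_sinh {y : ℝ} (hy : y ∈ Ico (0 : ℝ) 1) :
    ∃ K, StrictAntiOn (fun k => k * Real.cosh (k * y) / Real.sinh k) (Ici K) := by
  obtain ⟨hy0, hy1⟩ := hy
  have hy1' : 0 < 1 - y := by linarith
  refine ⟨1 / (1 - y), strictAntiOn_Ici_of_hasDerivAt_neg (f' := fun k =>
    ((1 * Real.cosh (k * y) + k * (Real.sinh (k * y) * y)) * Real.sinh k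
      - k * Real.cosh (k * y) * Real.cosh k) / Real.sinh k ^ 2) ?_ ?_⟩
  all_goals
    intro k hk
    have hk0 : 0 < k := lt_of_lt_of_le (by positivity) hk
    have hs : 0 < Real.sinh k := Real.sinh_pos_iff.2 hk0
  · have h1 : HasDerivAt (fun k : ℝ => k * y) y k := by
      simpa using (hasDerivAt_id k).mul_const y
    exact ((hasDerivAt_id k).mul h1.cosh).div (Real.hasDerivAt_sinh k) hs.ne'
  · refine div_neg_of_neg_of_pos ?_ (by positivity)
    have hsc : Real.sinh k < Real.cosh k := Real.sinh_lt_cosh k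
    have hsc' : Real.sinh (k * y) < Real.cosh (k * y) := Real.sinh_lt_cosh _
    have hc : 0 < Real.cosh (k * y) := Real.cosh_pos _
    have hky : 1 + k * y ≤ k := by
      rw [ge_iff_le, div_le_iff₀ hy1'] at hk
      linarith
    calc (1 * Real.cosh (k * y) + k * (Real.sinh (k * y) * y)) * Real.sinh k
          - k * Real.cosh (k * y) * Real.cosh k
        ≤ (1 + k * y) * Real.cosh (k * y) * Real.sinh k
          - k * Real.cosh (k * y) * Real.cosh k := by
          have : k * y * Real.sinh (k * y) ≤ k * y * Real.cosh (k * y) :=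
            mul_le_mul_of_nonneg_left hsc'.le (by positivity)
          have := mul_le_mul_of_nonneg_right this hs.le
          linarith
      _ ≤ k * Real.cosh (k * y) * Real.sinh k - k * Real.cosh (k * y) * Real.cosh k := by
          have : (1 + k * y) * (Real.cosh (k * y) * Real.sinh k)
              ≤ k * (Real.cosh (k * y) * Real.sinh k) :=
            mul_le_mul_of_nonneg_right hky (by positivity)
          linarith
      _ < 0 := by
          have : k * Real.cosh (k * y) * Real.sinh k < k * Real.cosh (k * y) * Real.cosh k :=
            mul_lt_mul_of_pos_left hsc (by positivity)
          linarith

/-! ### The symbol `∫₀¹ μ(α) z^α dα` determines the weight `μ` -/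

/-- A continuous function on `[0, 1]` orthogonal to all `exp (n α)`, `n ∈ ℕ`, vanishes: the
polynomials in `exp α` are dense in the continuous functions. -/
theorem eqOn_zero_of_integral_mul_exp_eq_zero {f : ℝ → ℝ} (hf : ContinuousOn f (Icc 0 1))
    (h : ∀ n : ℕ, ∫ α in (0 : ℝ)..1, f α * Real.exp α ^ n = 0) : EqOn f 0 (Icc 0 1) := by
  have hf' : ContinuousOn f (uIcc 0 1) := by rwa [uIcc_of_le zero_le_one]
  have hpoly : ∀ p : Polynomial ℝ, ∫ α in (0 : ℝ)..1, f α * p.eval (Real.exp α) = 0 := by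
    intro p
    simp_rw [Polynomial.eval_eq_sum_range, Finset.mul_sum]
    rw [intervalIntegral.integral_finsetSum]
    · refine Finset.sum_eq_zero fun n _ => ?_
      simp_rw [mul_left_comm (f _)]
      rw [intervalIntegral.integral_const_mul, h n, mul_zero]
    · intro n _
      exact (hf'.mul (by fun_prop)).intervalIntegrable
  have hsq : ∫ α in (0 : ℝ)..1, f α ^ 2 = 0 := by
    have hnn : 0 ≤ ∫ α in (0 : ℝ)..1, f α ^ 2 :=
      intervalIntegral.integral_nonneg zero_le_one fun _ _ => sq_nonneg _
    have hAn : 0 ≤ ∫ α in (0 : ℝ)..1, |f α| :=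
      intervalIntegral.integral_nonneg zero_le_one fun _ _ => abs_nonneg _
    set A := ∫ α in (0 : ℝ)..1, |f α| with hA
    have hle : ∀ ε > 0, ∫ α in (0 : ℝ)..1, f α ^ 2 ≤ ε * A := by
      intro ε hε
      have hlog : ContinuousOn (fun y => f (Real.log y)) (Icc 1 (Real.exp 1)) := by
        refine hf.comp (Real.continuousOn_log.mono fun y hy => ?_) fun y hy => ?_
        · exact (zero_lt_one.trans_le hy.1).ne'
        · exact ⟨Real.log_nonneg hy.1,
            (Real.log_le_iff_le_exp (zero_lt_one.trans_le hy.1)).2 hy.2⟩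
      obtain ⟨p, hp⟩ := exists_polynomial_near_of_continuousOn _ _ _ hlog ε hε
      have hp' : ∀ α ∈ Icc (0 : ℝ) 1, |p.eval (Real.exp α) - f α| < ε := by
        intro α hα
        simpa using hp (Real.exp α) ⟨Real.one_le_exp hα.1, Real.exp_le_exp.2 hα.2⟩
      have hsqc : ContinuousOn (fun α => f α ^ 2) (uIcc 0 1) := hf'.pow 2
      have hpc : ContinuousOn (fun α => f α * p.eval (Real.exp α)) (uIcc 0 1) :=
        hf'.mul (p.continuous.comp Real.continuous_exp).continuousOn
      calc ∫ α in (0 : ℝ)..1, f α ^ 2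
          = ∫ α in (0 : ℝ)..1, (f α ^ 2 - f α * p.eval (Real.exp α)) := by
            rw [intervalIntegral.integral_sub hsqc.intervalIntegrable
              hpc.intervalIntegrable, hpoly, sub_zero]
        _ ≤ ∫ α in (0 : ℝ)..1, ε * |f α| := by
            refine intervalIntegral.integral_mono_on zero_le_one
              (hsqc.sub hpc).intervalIntegrable
              (hf'.abs.const_mul ε).intervalIntegrable fun α hα => ?_
            calc f α ^ 2 - f α * p.eval (Real.exp α)
                = f α * (f α - p.eval (Real.exp α)) := by ring
              _ ≤ |f α| * |f α - p.eval (Real.exp α)| := by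
                  rw [← abs_mul]; exact le_abs_self _
              _ ≤ |f α| * ε := by
                  refine mul_le_mul_of_nonneg_left ?_ (abs_nonneg _)
                  rw [abs_sub_comm]; exact (hp' α hα).le
              _ = ε * |f α| := mul_comm _ _
        _ = ε * A := intervalIntegral.integral_const_mul _ _
    refine le_antisymm (le_of_forall_pos_le_add fun δ hδ => ?_) hnn
    refine (hle (δ / (A + 1)) (by positivity)).trans ?_
    rw [zero_add, div_mul_eq_mul_div, div_le_iff₀ (by positivity)]
    nlinarith
  intro x hx
  by_contra hne
  have := intervalIntegral.integral_pos (zero_lt_one' ℝ) (hf.pow 2) (fun _ _ => sq_nonneg _)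
    ⟨x, hx, pow_pos (abs_pos.2 hne) 2 |>.trans_eq (sq_abs _)⟩
  exact this.ne' hsq

/-- The Laplace symbol `∫₀¹ μ(α) z^α dα` of the distributed-order derivative. -/
noncomputable def distSymbol (μ : ℝ → ℝ) (z : ℝ) : ℝ :=
  ∫ α in (0 : ℝ)..1, μ α * z ^ α

theorem eqOn_of_distSymbol_eq {μ₁ μ₂ : ℝ → ℝ} (h₁ : ContinuousOn μ₁ (Icc 0 1))
    (h₂ : ContinuousOn μ₂ (Icc 0 1)) {Z : ℝ} (h : ∀ z ≥ Z, distSymbol μ₁ z = distSymbol μ₂ z) :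
    EqOn μ₁ μ₂ (Icc 0 1) := by
  set s := max Z 0 with hs
  have hc : ∀ μ : ℝ → ℝ, ContinuousOn μ (Icc 0 1) → ∀ w : ℝ,
      IntervalIntegrable (fun α => μ α * Real.exp (w * α)) volume 0 1 := fun μ hμ w =>
    ContinuousOn.intervalIntegrable_of_Icc zero_le_one (hμ.mul (by fun_prop))
  -- The symbols agree at the points `z = exp (s + n)`, `n ∈ ℕ`.
  have key := eqOn_zero_of_integral_mul_exp_eq_zero
    (f := fun α => (μ₁ α - μ₂ α) * Real.exp (s * α)) ((h₁.sub h₂).mul (by fun_prop)) (by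
      intro n
      have hz : Z ≤ Real.exp (s + n) := by
        have := Real.add_one_le_exp (s + n)
        have h1 : Z ≤ s := le_max_left _ _
        have h2 : (0 : ℝ) ≤ n := n.cast_nonneg
        linarith
      have := h _ hz
      simp only [distSymbol] at this
      have e : ∀ α : ℝ, Real.exp (s + n) ^ α = Real.exp ((s + n) * α) := fun α => by
        rw [← Real.exp_mul]
      simp_rw [e] at this
      rw [← sub_eq_zero, ← intervalIntegral.integral_sub (hc _ h₁ _) (hc _ h₂ _)] at this
      refine Eq.trans (intervalIntegral.integral_congr fun α _ => ?_) this
      rw [add_mul, Real.exp_add, Real.exp_nat_mul]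
      ring)
  intro α hα
  have := key hα
  simp only [Pi.zero_apply, mul_eq_zero, (Real.exp_pos _).ne', or_false] at this
  linarith

theorem tendsto_distSymbol_atTop {μ : ℝ → ℝ} {C b₀ b₁ : ℝ} (hC : 0 < C) (hb₀ : 0 ≤ b₀)
    (hb : b₀ < b₁) (hb₁ : b₁ ≤ 1) (hμ : μ ∈ admissibleClass C b₀ b₁) :
    Tendsto (distSymbol μ) atTop atTop := by
  obtain ⟨hcd, hnn, -, hlb⟩ := hμ
  have hc := hcd.continuousOn
  -- Half of the interval keeps the exponent positive even if `b₀ = 0`.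
  set m := (b₀ + b₁) / 2 with hm
  have hm0 : 0 < m := by rw [hm]; linarith
  have hmb : m < b₁ := by rw [hm]; linarith
  have hbm : b₀ < m := by rw [hm]; linarith
  have hlim : Tendsto (fun z : ℝ => (b₁ - m) * C * z ^ m) atTop atTop :=
    (tendsto_rpow_atTop hm0).const_mul_atTop (mul_pos (by linarith) hC)
  refine tendsto_atTop_mono' _ ?_ hlim
  filter_upwards [eventually_ge_atTop 1] with z hz
  have hz0 : 0 < z := by linarith
  have hzc : Continuous fun α : ℝ => z ^ α := Real.continuous_const_rpow hz0.ne'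
  have hint : ∀ a b : ℝ, a ∈ Icc (0 : ℝ) 1 → b ∈ Icc (0 : ℝ) 1 →
      IntervalIntegrable (fun α => μ α * z ^ α) volume a b := fun a b ha hb' =>
    ((hc.mul hzc.continuousOn).mono (ordConnected_Icc.uIcc_subset ha hb')).intervalIntegrable
  have hpos : ∀ α ∈ Icc (0 : ℝ) 1, 0 ≤ μ α * z ^ α := fun α hα =>
    mul_nonneg (hnn α hα) (Real.rpow_nonneg hz0.le _)
  have hmm : m ∈ Icc (0 : ℝ) 1 := ⟨hm0.le, by linarith⟩
  have hbb : b₁ ∈ Icc (0 : ℝ) 1 := ⟨by linarith, hb₁⟩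
  have h1 : ∫ _ in m..b₁, C * z ^ m ≤ ∫ α in m..b₁, μ α * z ^ α := by
    refine intervalIntegral.integral_mono_on_of_le_Ioo hmb.le (by simp) (hint _ _ hmm hbb)
      fun α hα => ?_
    exact mul_le_mul (hlb α ⟨hbm.trans hα.1, hα.2⟩)
      (Real.rpow_le_rpow_of_exponent_le hz hα.1.le) (Real.rpow_nonneg hz0.le _)
      (hnn α ⟨hm0.le.trans hα.1.le, hα.2.le.trans hb₁⟩)
  have h2 : ∫ α in m..b₁, μ α * z ^ α ≤ distSymbol μ z := by
    refine intervalIntegral.integral_mono_interval hm0.le hmb.le hb₁ ?_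
      (hint _ _ (by simp) (by simp))
    exact (ae_restrict_iff' measurableSet_Ioc).2
      (ae_of_all _ fun α hα => hpos α (Ioc_subset_Icc_self hα))
  rw [intervalIntegral.integral_const, smul_eq_mul] at h1
  linarith

/-! ### The Laplace transform -/

/-- The integral defining the Laplace transform of `f` at `z` converges absolutely. -/
def LaplaceIntegrable (f : ℝ → ℝ) (z : ℝ) : Prop :=
  IntegrableOn (fun t => Real.exp (-(z * t)) * f t) (Ioi 0)

theorem laplaceTransform_congr_ae {f g : ℝ → ℝ} (h : f =ᵐ[timeMeasure] g) (z : ℝ) :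
    laplaceTransform f z = laplaceTransform g z :=
  integral_congr_ae (h.mono fun t ht => by simp only [ht])

theorem laplaceIntegrable_one {z : ℝ} (hz : 0 < z) : LaplaceIntegrable (fun _ => 1) z := by
  simpa [LaplaceIntegrable, neg_mul] using exp_neg_integrableOn_Ioi 0 hz

theorem laplaceTransform_one {z : ℝ} (hz : 0 < z) : laplaceTransform (fun _ => 1) z = 1 / z := by
  have := integral_exp_mul_Ioi (a := -z) (by linarith) 0
  simp only [laplaceTransform, mul_one, ← neg_mul]
  rw [this]
  simp

theorem LaplaceIntegrable.intervalIntegrable {f : ℝ → ℝ} {z : ℝ} (hf : LaplaceIntegrable f z)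
    {T : ℝ} (hT : 0 ≤ T) : IntervalIntegrable f volume 0 T := by
  rw [intervalIntegrable_iff_integrableOn_Ioc_of_le hT]
  have h1 : IntervalIntegrable (fun t => Real.exp (-(z * t)) * f t) volume 0 T :=
    (intervalIntegrable_iff_integrableOn_Ioc_of_le hT).2
      (IntegrableOn.mono_set hf Ioc_subset_Ioi_self)
  have h2 := h1.continuousOn_mul (g := fun t => Real.exp (z * t)) (by fun_prop)
  refine ((intervalIntegrable_iff_integrableOn_Ioc_of_le hT).1 h2).congr (ae_of_all _ fun t => ?_)
  simp only
  rw [← mul_assoc, ← Real.exp_add]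
  simp

/-- The Laplace transform turns convolution into multiplication. -/
theorem laplaceTransform_convolution {f g : ℝ → ℝ} {z : ℝ} (hf : LaplaceIntegrable f z)
    (hg : LaplaceIntegrable g z) :
    laplaceTransform (fun t => ∫ τ in (0 : ℝ)..t, f τ * g (t - τ)) z =
      laplaceTransform f z * laplaceTransform g z := by
  have := integral_posConvolution hf hg (ContinuousLinearMap.mul ℝ ℝ)
  simp only [ContinuousLinearMap.mul_apply'] at this
  rw [laplaceTransform, laplaceTransform, laplaceTransform, ← this]
  refine integral_congr_ae (ae_of_all _ fun t => ?_)
  simp only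
  rw [← intervalIntegral.integral_const_mul]
  refine intervalIntegral.integral_congr fun τ _ => ?_
  have : Real.exp (-(z * t)) = Real.exp (-(z * τ)) * Real.exp (-(z * (t - τ))) := by
    rw [← Real.exp_add]; ring_nf
  simp only [this]
  ring

/-- The Laplace transform of the kernel `η` is `z⁻¹ ∫₀¹ μ(α) z^α dα`. -/
theorem laplaceTransform_distKernel {μ : ℝ → ℝ} (hμ : ContinuousOn μ (Icc 0 1))
    (hμ0 : ∀ α ∈ Icc (0 : ℝ) 1, 0 ≤ μ α) {z : ℝ} (hz : 0 < z) :
    LaplaceIntegrable (distKernel μ) z ∧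
      laplaceTransform (distKernel μ) z = distSymbol μ z / z := by
  set F : ℝ → ℝ → ℝ := fun s α =>
    Real.exp (-(z * s)) * (μ α / Real.Gamma (1 - α) * s ^ (-α)) with hF
  have hval : ∀ α ∈ Ioo (0 : ℝ) 1, ∫ s in Ioi (0 : ℝ), F s α = μ α * z ^ α / z := by
    intro α hα
    have h1 := Real.integral_rpow_mul_exp_neg_mul_Ioi (a := 1 - α) (by linarith [hα.2]) hz
    have hG : 0 < Real.Gamma (1 - α) := Real.Gamma_pos_of_pos (by linarith [hα.2])
    have e : ∀ s, F s α = μ α / Real.Gamma (1 - α) *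
        (s ^ (1 - α - 1) * Real.exp (-(z * s))) := by
      intro s
      rw [hF]
      simp only
      rw [show 1 - α - 1 = -α by ring]
      ring
    simp_rw [e]
    rw [integral_const_mul, h1, one_div, Real.inv_rpow hz.le, ← Real.rpow_neg hz.le,
      show -(1 - α) = α - 1 by ring, Real.rpow_sub_one hz.ne']
    field_simp
  have hmeas : AEStronglyMeasurable (Function.uncurry F)
      ((volume.restrict (Ioi 0)).prod (volume.restrict (Ioo 0 1))) := by
    rw [Measure.prod_restrict]
    refine ContinuousOn.aestronglyMeasurable ?_ (measurableSet_Ioi.prod measurableSet_Ioo)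
    have c1 : ContinuousOn (fun p : ℝ × ℝ => μ p.2) (Ioi 0 ×ˢ Ioo 0 1) :=
      hμ.comp continuousOn_snd fun p hp => Ioo_subset_Icc_self hp.2
    have c2 : ContinuousOn (fun p : ℝ × ℝ => Real.Gamma (1 - p.2)) (Ioi 0 ×ˢ Ioo 0 1) := by
      intro p hp
      have hp1 : 0 < 1 - p.2 := by linarith [hp.2.2]
      refine ContinuousAt.continuousWithinAt ?_
      refine ContinuousAt.comp (f := fun p : ℝ × ℝ => 1 - p.2) (g := Real.Gamma) ?_ (by fun_prop)
      refine (Real.differentiableAt_Gamma fun m h => ?_).continuousAt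
      have : (0 : ℝ) ≤ m := m.cast_nonneg
      linarith
    have c3 : ContinuousOn (fun p : ℝ × ℝ => p.1 ^ (-p.2)) (Ioi 0 ×ˢ Ioo 0 1) :=
      continuousOn_fst.rpow continuousOn_snd.neg fun p hp => Or.inl (ne_of_gt hp.1)
    have c4 : ContinuousOn (fun p : ℝ × ℝ => Real.exp (-(z * p.1))) (Ioi 0 ×ˢ Ioo 0 1) := by
      fun_prop
    refine c4.mul ((c1.div c2 fun p hp => ?_).mul c3)
    exact (Real.Gamma_pos_of_pos (by linarith [hp.2.2])).ne'
  have hnn : ∀ s ∈ Ioi (0 : ℝ), ∀ α ∈ Ioo (0 : ℝ) 1, 0 ≤ F s α := by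
    intro s hs α hα
    have := Real.Gamma_pos_of_pos (s := 1 - α) (by linarith [hα.2])
    have := hμ0 α (Ioo_subset_Icc_self hα)
    have := Real.rpow_nonneg (le_of_lt hs) (-α)
    positivity
  have hcz : ContinuousOn (fun α => μ α * z ^ α / z) (Icc 0 1) :=
    (hμ.mul (Real.continuous_const_rpow hz.ne').continuousOn).div_const z
  have hsmul : ∀ α ∈ Ioo (0 : ℝ) 1, Integrable (fun s => F s α) (volume.restrict (Ioi 0)) := by
    intro α hα
    have h1 := integrableOn_rpow_mul_exp_neg_mul_rpow (p := 1) (s := -α) (by linarith [hα.2])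
      one_pos hz
    refine (h1.const_mul (μ α / Real.Gamma (1 - α))).congr (ae_of_all _ fun s => ?_)
    simp only [hF, Real.rpow_one, neg_mul]
    ring
  have hint : Integrable (Function.uncurry F)
      ((volume.restrict (Ioi 0)).prod (volume.restrict (Ioo 0 1))) := by
    rw [integrable_prod_iff' hmeas]
    refine ⟨(ae_restrict_iff' measurableSet_Ioo).2 (ae_of_all _ hsmul), ?_⟩
    have : IntegrableOn (fun α => μ α * z ^ α / z) (Ioo 0 1) :=
      (hcz.integrableOn_Icc).mono_set Ioo_subset_Icc_self
    refine this.congr ((ae_restrict_iff' measurableSet_Ioo).2 (ae_of_all _ fun α hα => ?_))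
    refine (hval α hα).symm.trans ?_
    refine setIntegral_congr_fun measurableSet_Ioi fun s hs => ?_
    exact (Real.norm_of_nonneg (hnn s hs α hα)).symm
  have hker : ∀ s, ∫ α in Ioo (0 : ℝ) 1, F s α = Real.exp (-(z * s)) * distKernel μ s := by
    intro s
    simp only [hF]
    rw [integral_const_mul, distKernel, intervalIntegral.integral_of_le zero_le_one,
      integral_Ioc_eq_integral_Ioo]
  constructor
  · have := hint.integral_prod_left
    simp only [Function.uncurry_apply_pair, hker] at this
    exact this
  · have := integral_integral_swap hint
    simp only [hker] at this
    rw [laplaceTransform, this, setIntegral_congr_fun measurableSet_Ioo hval, integral_div,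
      distSymbol, intervalIntegral.integral_of_le zero_le_one, integral_Ioc_eq_integral_Ioo]

/-- Associativity of the forward convolution with the constant `1` as third factor:
`1 * (a * b) = a * (1 * b)`. -/
theorem integral_integral_mul_sub_eq {a b : ℝ → ℝ} {T : ℝ} (hT : 0 < T)
    (ha : IntervalIntegrable a volume 0 T) (hb : IntervalIntegrable b volume 0 T) :
    ∫ s in (0 : ℝ)..T, ∫ τ in (0 : ℝ)..s, a τ * b (s - τ) =
      ∫ τ in (0 : ℝ)..T, a τ * ∫ r in (0 : ℝ)..(T - τ), b r := by
  set M := ContinuousLinearMap.mul ℝ ℝ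
  -- The factors are cut off at time `T`, which makes them integrable on the line.
  set a₀ := indicator (Iic T) a with ha₀
  set b₀ := indicator (Iic T) b with hb₀
  set o : ℝ → ℝ := fun _ => 1
  set A := indicator (Ioi 0) a₀
  set B := indicator (Ioi 0) b₀
  set O := indicator (Ioi (0 : ℝ)) o
  have hA : Integrable A := by
    rw [integrable_indicator_iff measurableSet_Ioi, IntegrableOn,
      integrable_indicator_iff measurableSet_Iic, IntegrableOn,
      Measure.restrict_restrict measurableSet_Iic, Iic_inter_Ioi]
    exact (intervalIntegrable_iff_integrableOn_Ioc_of_le hT.le).1 ha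
  have hB : Integrable B := by
    rw [integrable_indicator_iff measurableSet_Ioi, IntegrableOn,
      integrable_indicator_iff measurableSet_Iic, IntegrableOn,
      Measure.restrict_restrict measurableSet_Iic, Iic_inter_Ioi]
    exact (intervalIntegrable_iff_integrableOn_Ioc_of_le hT.le).1 hb
  have hOm : Measurable O := measurable_const.indicator measurableSet_Ioi
  have hO1 : ∀ x, ‖O x‖ ≤ 1 := fun x =>
    (norm_indicator_le_norm_self _ _).trans (by simp [o])
  have hassoc := convolution_assoc' (μ := volume) (ν := volume) M M M M (f := A) (g := B) (k := O)
    (x₀ := T) (fun x y w => by simp [M, mul_assoc]) (hA.ae_convolution_exists M hB)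
    (ae_of_all _ fun x => by
      refine hB.mul_bdd (c := 1) ?_ (ae_of_all _ fun y => hO1 _)
      exact (hOm.comp (measurable_const.sub measurable_id)).aestronglyMeasurable)
    (by
      have h1 := (hA.convolution_integrand (μ := volume) M hB)
      have h2 := h1.mul_bdd (c := 1) (g := fun p : ℝ × ℝ => O (T - p.1))
        (hOm.comp (measurable_const.sub measurable_fst)).aestronglyMeasurable
        (ae_of_all _ fun p => hO1 _)
      refine h2.congr (ae_of_all _ fun p => ?_)
      simp [M, Function.uncurry, mul_assoc])
  have e1 : convolution A B M volume = posConvolution a₀ b₀ M volume :=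
    (posConvolution_eq_convolution_indicator a₀ b₀ M volume).symm
  have e2 : convolution B O M volume = posConvolution b₀ o M volume :=
    (posConvolution_eq_convolution_indicator b₀ o M volume).symm
  have e3 : convolution (posConvolution a₀ b₀ M volume) O M volume =
      posConvolution (fun x => ∫ t in (0 : ℝ)..x, M (a₀ t) (b₀ (x - t))) o M volume :=
    (posConvolution_eq_convolution_indicator _ o M volume).symm
  have e4 : convolution A (posConvolution b₀ o M volume) M volume =
      posConvolution a₀ (fun x => ∫ t in (0 : ℝ)..x, M (b₀ t) (o (x - t))) M volume :=
    (posConvolution_eq_convolution_indicator a₀ _ M volume).symm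
  rw [e1, e2, e3, e4, posConvolution, posConvolution] at hassoc
  rw [indicator_of_mem (show T ∈ Ioi 0 from hT), indicator_of_mem (show T ∈ Ioi 0 from hT)]
    at hassoc
  simp only [M, o, ContinuousLinearMap.mul_apply', mul_one] at hassoc
  convert hassoc using 1
  · refine intervalIntegral.integral_congr fun s hs => ?_
    rw [uIcc_of_le hT.le] at hs
    refine intervalIntegral.integral_congr fun τ hτ => ?_
    rw [uIcc_of_le hs.1] at hτ
    simp only [ha₀, hb₀]
    rw [indicator_of_mem (show τ ∈ Iic T from hτ.2.trans hs.2),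
      indicator_of_mem (show s - τ ∈ Iic T from by
        have h1 := hτ.1
        have h2 := hs.2
        simp only [mem_Iic]; linarith)]
  · refine intervalIntegral.integral_congr fun τ hτ => ?_
    rw [uIcc_of_le hT.le] at hτ
    simp only [ha₀]
    rw [indicator_of_mem (show τ ∈ Iic T from hτ.2)]
    congr 1
    refine intervalIntegral.integral_congr fun r hr => ?_
    rw [uIcc_of_le (by linarith [hτ.2])] at hr
    simp only [hb₀]
    rw [indicator_of_mem (show r ∈ Iic T from by
      have h1 := hτ.1
      have h2 := hr.2
      simp only [mem_Iic]; linarith)]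

/-- The distributed-order derivative acts under the Laplace transform as multiplication by its
symbol. Since `v'` need not have a Laplace transform, the identity is derived from the integrated
equation `1 * w = η * v`. -/
theorem laplaceTransform_of_distDeriv_eq {μ v w : ℝ → ℝ} (hμ : ContinuousOn μ (Icc 0 1))
    (hμ0 : ∀ α ∈ Icc (0 : ℝ) 1, 0 ≤ μ α) {z : ℝ} (hz : 0 < z)
    (hv : ∀ T > 0, AbsolutelyContinuousOnInterval v 0 T) (hv0 : v 0 = 0)
    (hvz : LaplaceIntegrable v z) (hwz : LaplaceIntegrable w z)
    (hw : ∀ᵐ t ∂timeMeasure, distDeriv μ v t = w t) :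
    laplaceTransform w z = distSymbol μ z * laplaceTransform v z := by
  obtain ⟨hη, hLη⟩ := laplaceTransform_distKernel hμ hμ0 hz
  have hD : ∀ t, distDeriv μ v t = ∫ τ in (0 : ℝ)..t, distKernel μ τ * deriv v (t - τ) := by
    intro t
    have := intervalIntegral.integral_comp_sub_left (a := 0) (b := t)
      (fun τ => distKernel μ τ * deriv v (t - τ)) t
    simp only [sub_sub_cancel, sub_self, sub_zero] at this
    rw [← this, distDeriv]
  have hint : ∀ t > 0, ∫ s in (0 : ℝ)..t, 1 * w (t - s) =
      ∫ τ in (0 : ℝ)..t, distKernel μ τ * v (t - τ) := by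
    intro t ht
    have h1 : ∫ s in (0 : ℝ)..t, 1 * w (t - s) = ∫ s in (0 : ℝ)..t, w s := by
      simp
    have h2 : ∫ s in (0 : ℝ)..t, w s = ∫ s in (0 : ℝ)..t, distDeriv μ v s := by
      refine intervalIntegral.integral_congr_ae ?_
      filter_upwards [(ae_restrict_iff' measurableSet_Ioi).1 hw] with s hs hs'
      rw [uIoc_of_le ht.le] at hs'
      exact (hs hs'.1).symm
    rw [h1, h2]
    simp_rw [hD]
    rw [integral_integral_mul_sub_eq ht (hη.intervalIntegrable ht.le)
      (hv t ht).intervalIntegrable_deriv]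
    refine intervalIntegral.integral_congr fun τ hτ => ?_
    rw [uIcc_of_le ht.le] at hτ
    congr 1
    rcases hτ.2.eq_or_lt with h | h
    · simp [h, hv0]
    · rw [(hv (t - τ) (by linarith)).integral_deriv_eq_sub, hv0, sub_zero]
  have hL : laplaceTransform (fun t => ∫ s in (0 : ℝ)..t, 1 * w (t - s)) z =
      laplaceTransform (fun t => ∫ τ in (0 : ℝ)..t, distKernel μ τ * v (t - τ)) z :=
    laplaceTransform_congr_ae
      ((ae_restrict_iff' measurableSet_Ioi).2 (ae_of_all _ fun t ht => hint t ht)) z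
  rw [laplaceTransform_convolution (laplaceIntegrable_one hz) hwz,
    laplaceTransform_convolution hη hvz, laplaceTransform_one hz, hLη] at hL
  field_simp at hL
  exact hL

/-! ### Laplace transforms of square integrable functions -/

theorem memLp_exp_neg_mul {z : ℝ} (hz : 0 < z) :
    MemLp (fun t => Real.exp (-(z * t))) 2 timeMeasure := by
  rw [memLp_two_iff_integrable_sq (by fun_prop)]
  have := exp_neg_integrableOn_Ioi 0 (b := 2 * z) (by linarith)
  refine Integrable.congr this (ae_of_all _ fun t => ?_)
  simp only
  rw [← Real.exp_nat_mul]
  congr 1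
  push_cast
  ring

theorem laplaceIntegrable_of_memLp {f : ℝ → ℝ} (hf : MemLp f 2 timeMeasure) {z : ℝ} (hz : 0 < z) :
    LaplaceIntegrable f z :=
  (memLp_exp_neg_mul hz).integrable_mul hf

/-- `L²` convergence implies convergence in `L¹` with the exponential weight. -/
theorem tendsto_eLpNorm_exp_mul_sub {ι : Type*} {l : Filter ι} {F : ι → ℝ → ℝ} {f : ℝ → ℝ}
    (hF : ∀ᶠ i in l, MemLp (F i) 2 timeMeasure) (hf : MemLp f 2 timeMeasure)
    (h : Tendsto (fun i => eLpNorm (fun t => F i t - f t) 2 timeMeasure) l (𝓝 0))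
    {z : ℝ} (hz : 0 < z) :
    Tendsto (fun i => eLpNorm ((fun t => Real.exp (-(z * t)) * F i t) -
      fun t => Real.exp (-(z * t)) * f t) 1 timeMeasure) l (𝓝 0) := by
  have hE := memLp_exp_neg_mul hz
  have hlim : Tendsto (fun i => eLpNorm (fun t => Real.exp (-(z * t))) 2 timeMeasure *
      eLpNorm (fun t => F i t - f t) 2 timeMeasure) l (𝓝 0) := by
    have := ENNReal.Tendsto.const_mul h (Or.inr hE.eLpNorm_lt_top.ne)
    rwa [mul_zero] at this
  refine tendsto_of_tendsto_of_tendsto_of_le_of_le' tendsto_const_nhds hlim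
    (Eventually.of_forall fun _ => zero_le) ?_
  filter_upwards [hF] with i hi
  have := eLpNorm_smul_le_mul_eLpNorm (p := 2) (q := 2) (r := 1) (hi.sub hf).1 hE.1
  refine le_trans (le_of_eq (congrArg (fun g => eLpNorm g 1 timeMeasure) ?_)) this
  ext t
  simp [mul_sub]

theorem tendsto_laplaceTransform {ι : Type*} {l : Filter ι} {F : ι → ℝ → ℝ} {f : ℝ → ℝ}
    (hF : ∀ᶠ i in l, MemLp (F i) 2 timeMeasure) (hf : MemLp f 2 timeMeasure)
    (h : Tendsto (fun i => eLpNorm (fun t => F i t - f t) 2 timeMeasure) l (𝓝 0))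
    {z : ℝ} (hz : 0 < z) :
    Tendsto (fun i => laplaceTransform (F i) z) l (𝓝 (laplaceTransform f z)) :=
  tendsto_integral_of_L1' _ (laplaceIntegrable_of_memLp hf hz).1
    (hF.mono fun _ hi => laplaceIntegrable_of_memLp hi hz) (tendsto_eLpNorm_exp_mul_sub hF hf h hz)

theorem ContinuousIntoL2.continuousOn_laplaceTransform {v : ℝ → ℝ → ℝ} {S : Set ℝ}
    (hv : ContinuousIntoL2 v S) {z : ℝ} (hz : 0 < z) :
    ContinuousOn (fun x => laplaceTransform (v x) z) S := fun x hx =>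
  tendsto_laplaceTransform (eventually_mem_nhdsWithin.mono hv.1) (hv.1 x hx) (hv.2 x hx) hz

theorem ContinuousIntoL2.continuousOn_integral_norm {v : ℝ → ℝ → ℝ} {S : Set ℝ}
    (hv : ContinuousIntoL2 v S) {z : ℝ} (hz : 0 < z) :
    ContinuousOn (fun x => ∫ t in Ioi (0 : ℝ), ‖Real.exp (-(z * t)) * v x t‖) S := by
  intro x hx
  have hF : ∀ᶠ y in 𝓝[S] x, MemLp (v y) 2 timeMeasure := eventually_mem_nhdsWithin.mono hv.1
  refine tendsto_integral_of_L1' _ (laplaceIntegrable_of_memLp (hv.1 x hx) hz).norm.1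
    (hF.mono fun _ hi => (laplaceIntegrable_of_memLp hi hz).norm) ?_
  refine tendsto_of_tendsto_of_tendsto_of_le_of_le tendsto_const_nhds
    (tendsto_eLpNorm_exp_mul_sub hF (hv.1 x hx) (hv.2 x hx) hz) (fun _ => zero_le) fun y => ?_
  refine eLpNorm_mono fun t => ?_
  exact abs_norm_sub_norm_le _ _

/-! ### Interchanging the Laplace transform with integration in `x` -/

/-- Absolute convergence of the double integral of `exp (-z t) v(x, t) ρ(x)`: the weighted `L¹` norm
of `v x` is continuous, hence bounded, on `[a, b]`. -/
theorem ContinuousIntoL2.integrable_prod {v : ℝ → ℝ → ℝ}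
    (hv : ContinuousIntoL2 v (Ioc 0 1)) (hc : ContinuousOn (Function.uncurry v) (Ioc 0 1 ×ˢ Ioi 0))
    {ρ : ℝ → ℝ} {a b : ℝ} (ha : 0 < a) (hb : b ≤ 1) (hρ : ContinuousOn ρ (Icc a b))
    {z : ℝ} (hz : 0 < z) :
    Integrable (Function.uncurry fun x t => Real.exp (-(z * t)) * (v x t * ρ x))
      ((volume.restrict (Ioc a b)).prod (volume.restrict (Ioi 0))) := by
  have hsub : Icc a b ⊆ Ioc 0 1 := fun x hx => ⟨ha.trans_le hx.1, hx.2.trans hb⟩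
  have hmeas : AEStronglyMeasurable
      (Function.uncurry fun x t => Real.exp (-(z * t)) * (v x t * ρ x))
      ((volume.restrict (Ioc a b)).prod (volume.restrict (Ioi 0))) := by
    rw [Measure.prod_restrict]
    refine ContinuousOn.aestronglyMeasurable ?_ (measurableSet_Ioc.prod measurableSet_Ioi)
    have c1 : ContinuousOn (fun p : ℝ × ℝ => Real.exp (-(z * p.2))) (Ioc a b ×ˢ Ioi 0) := by
      fun_prop
    refine c1.mul ((hc.mono ?_).mul
      (hρ.comp continuousOn_fst fun p hp => Ioc_subset_Icc_self hp.1))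
    exact prod_mono (Ioc_subset_Icc_self.trans hsub) Subset.rfl
  rw [integrable_prod_iff hmeas]
  constructor
  · refine (ae_restrict_iff' measurableSet_Ioc).2 (ae_of_all _ fun x hx => ?_)
    have := (laplaceIntegrable_of_memLp (hv.1 x (hsub (Ioc_subset_Icc_self hx))) hz).mul_const (ρ x)
    simpa only [Function.uncurry_apply_pair, mul_assoc] using this
  · have hc2 : ContinuousOn
        (fun x => (∫ t in Ioi (0 : ℝ), ‖Real.exp (-(z * t)) * v x t‖) * ‖ρ x‖) (Icc a b) :=
      ((hv.continuousOn_integral_norm hz).mono hsub).mul hρ.norm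
    refine Integrable.congr (hc2.integrableOn_Icc.mono_set Ioc_subset_Icc_self)
      (ae_of_all _ fun x => ?_)
    simp only [Function.uncurry_apply_pair, ← mul_assoc, norm_mul _ (ρ x)]
    rw [integral_mul_const]

theorem ContinuousIntoL2.laplaceTransform_integral {v : ℝ → ℝ → ℝ}
    (hv : ContinuousIntoL2 v (Ioc 0 1)) (hc : ContinuousOn (Function.uncurry v) (Ioc 0 1 ×ˢ Ioi 0))
    {ρ : ℝ → ℝ} {a b : ℝ} (ha : 0 < a) (hab : a ≤ b) (hb : b ≤ 1) (hρ : ContinuousOn ρ (Icc a b))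
    {z : ℝ} (hz : 0 < z) :
    LaplaceIntegrable (fun t => ∫ x in a..b, v x t * ρ x) z ∧
      laplaceTransform (fun t => ∫ x in a..b, v x t * ρ x) z =
        ∫ x in a..b, laplaceTransform (v x) z * ρ x := by
  have hint := hv.integrable_prod hc ha hb hρ hz
  have e : ∀ t, ∫ x in Ioc a b, Real.exp (-(z * t)) * (v x t * ρ x) =
      Real.exp (-(z * t)) * ∫ x in a..b, v x t * ρ x := fun t => by
    rw [integral_const_mul, intervalIntegral.integral_of_le hab]
  constructor
  · have := hint.integral_prod_right
    simp only [Function.uncurry_apply_pair, e] at this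
    exact this
  · have := integral_integral_swap hint
    simp only [e] at this
    rw [laplaceTransform, ← this, intervalIntegral.integral_of_le hab]
    refine integral_congr_ae (ae_of_all _ fun x => ?_)
    simp only [laplaceTransform, ← mul_assoc]
    rw [integral_mul_const]

theorem ContinuousIntoL2.laplaceTransform_integral_testFunction {v : ℝ → ℝ → ℝ}
    (hv : ContinuousIntoL2 v (Ioc 0 1)) (hc : ContinuousOn (Function.uncurry v) (Ioc 0 1 ×ˢ Ioi 0))
    {ψ : ℝ → ℝ} (hψ : IsTestFunction ψ) {z : ℝ} (hz : 0 < z) :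
    LaplaceIntegrable (fun t => ∫ x in (0 : ℝ)..1, v x t * ψ x) z ∧
      laplaceTransform (fun t => ∫ x in (0 : ℝ)..1, v x t * ψ x) z =
        ∫ x in (0 : ℝ)..1, laplaceTransform (v x) z * ψ x := by
  obtain ⟨a, b, ha, hab, hb, hs⟩ := hψ.exists_tsupport_subset_Ioo
  have e : ∀ h : ℝ → ℝ, ∫ x in (0 : ℝ)..1, h x * ψ x = ∫ x in a..b, h x * ψ x := fun h => by
    have hsup : (Function.support fun x => h x * ψ x) ⊆ Ioo a b := fun x hx =>
      hs (subset_tsupport _ (right_ne_zero_of_mul hx))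
    rw [intervalIntegral.integral_eq_integral_of_support_subset (hsup.trans Ioo_subset_Ioc_self),
      intervalIntegral.integral_eq_integral_of_support_subset]
    exact hsup.trans fun x hx => ⟨ha.trans hx.1, (hx.2.trans hb).le⟩
  simp_rw [e]
  exact hv.laplaceTransform_integral hc ha hab hb.le hψ.1.continuous.continuousOn hz

/-! ### The transformed weak solution -/

namespace IsWeakSolution

variable {μ g : ℝ → ℝ} {u : ℝ → ℝ → ℝ}

theorem integral_flux (hu : IsWeakSolution μ g u) {t : ℝ} (ht : 0 < t) {x y : ℝ}
    (hx : x ∈ Ioc (0 : ℝ) 1) (hy : y ∈ Ioc (0 : ℝ) 1) (hxy : x ≤ y) :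
    ∫ s in x..y, flux u s t = u y t - u x t := by
  have hsub : Icc x y ⊆ Ioc 0 1 := fun s hs => ⟨hx.1.trans_le hs.1, hs.2.trans hy.2⟩
  refine intervalIntegral.integral_eq_sub_of_hasDerivAt_of_le hxy
    ((hu.differentiableOn t ht).continuousOn.mono hsub) (fun s hs => ?_) ?_
  · have hs' : s ∈ Ioc (0 : ℝ) 1 := hsub (Ioo_subset_Icc_self hs)
    exact ((hu.differentiableOn t ht) s hs').hasDerivWithinAt.hasDerivAt
      (Ioc_mem_nhds hs'.1 (hs.2.trans_le hy.2))
  · refine ContinuousOn.intervalIntegrable_of_Icc hxy ?_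
    exact hu.continuousOn_flux.comp (f := fun s => (s, t)) (by fun_prop)
      fun s hs => ⟨hsub hs, ht⟩

theorem integral_laplaceTransform_flux (hu : IsWeakSolution μ g u) {z : ℝ} (hz : 0 < z) {x y : ℝ}
    (hx : x ∈ Ioc (0 : ℝ) 1) (hy : y ∈ Ioc (0 : ℝ) 1) (hxy : x ≤ y) :
    ∫ s in x..y, laplaceTransform (flux u s) z =
      laplaceTransform (u y) z - laplaceTransform (u x) z := by
  have h := (hu.continuousIntoL2_flux.laplaceTransform_integral hu.continuousOn_flux (ρ := 1) hx.1
    hxy hy.2 continuousOn_const hz).2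
  simp only [Pi.one_apply, mul_one] at h
  rw [← h, laplaceTransform, laplaceTransform, laplaceTransform,
    ← integral_sub (laplaceIntegrable_of_memLp (hu.continuousIntoL2.1 y hy) hz)
      (laplaceIntegrable_of_memLp (hu.continuousIntoL2.1 x hx) hz)]
  refine setIntegral_congr_fun measurableSet_Ioi fun t ht => ?_
  rw [hu.integral_flux ht hx hy hxy, mul_sub]

/-- The transform is continuously differentiable in `x`, with derivative the transform of the
flux. -/
theorem hasDerivAt_laplaceTransform (hu : IsWeakSolution μ g u) {z : ℝ} (hz : 0 < z) {x : ℝ}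
    (hx : x ∈ Ioo (0 : ℝ) 1) :
    HasDerivAt (fun x => laplaceTransform (u x) z) (laplaceTransform (flux u x) z) x := by
  have hV := (hu.continuousIntoL2_flux.continuousOn_laplaceTransform hz).mono Ioo_subset_Ioc_self
  have hx2 : x / 2 ∈ Ioo (0 : ℝ) 1 := ⟨by linarith [hx.1], by linarith [hx.1, hx.2]⟩
  have h1 : HasDerivAt (fun y => ∫ s in (x / 2)..y, laplaceTransform (flux u s) z)
      (laplaceTransform (flux u x) z) x := by
    refine intervalIntegral.integral_hasDerivAt_right ?_
      (hV.stronglyMeasurableAtFilter isOpen_Ioo x hx) (hV.continuousAt (isOpen_Ioo.mem_nhds hx))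
    exact (hV.mono (ordConnected_Ioo.uIcc_subset hx2 hx)).intervalIntegrable
  refine (h1.add_const (laplaceTransform (u (x / 2)) z)).congr_of_eventuallyEq ?_
  filter_upwards [Ioo_mem_nhds (show x / 2 < x by linarith [hx.1]) hx.2] with y hy
  rw [hu.integral_laplaceTransform_flux hz (Ioo_subset_Ioc_self hx2)
    ⟨hx2.1.trans hy.1, hy.2.le⟩ hy.1.le]
  ring

/-- The Laplace transforms in time of the solution and of its flux. -/
theorem laplaceTransform_eq (hu : IsWeakSolution μ g u) (hμ : ContinuousOn μ (Icc 0 1))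
    (hμ0 : ∀ α ∈ Icc (0 : ℝ) 1, 0 ≤ μ α) (hg : MemLp g 2 timeMeasure) {z : ℝ} (hz : 0 < z)
    (hpos : 0 < distSymbol μ z) {x : ℝ} (hx : x ∈ Ioc (0 : ℝ) 1) :
    laplaceTransform (u x) z = laplaceTransform g z *
        (Real.sinh (√(distSymbol μ z) * (1 - x)) / Real.sinh √(distSymbol μ z)) ∧
      laplaceTransform (flux u x) z = -(laplaceTransform g z *
        (√(distSymbol μ z) * Real.cosh (√(distSymbol μ z) * (1 - x)) /
          Real.sinh √(distSymbol μ z))) := by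
  refine eq_sinh_of_weak_ode (Real.sqrt_pos.2 hpos)
    (fun x hx => hu.hasDerivAt_laplaceTransform hz hx)
    (hu.continuousIntoL2.continuousOn_laplaceTransform hz)
    (hu.continuousIntoL2_flux.continuousOn_laplaceTransform hz) (fun ψ hψ => ?_) ?_ ?_ hx
  · obtain ⟨i1, e1⟩ :=
      hu.continuousIntoL2.laplaceTransform_integral_testFunction hu.continuousOn hψ hz
    obtain ⟨i2, e2⟩ := hu.continuousIntoL2.laplaceTransform_integral_testFunction hu.continuousOn
      (isTestFunction_deriv (isTestFunction_deriv hψ)) hz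
    rw [Real.sq_sqrt hpos.le, ← e1, ← e2]
    refine laplaceTransform_of_distDeriv_eq hμ hμ0 hz (hu.absolutelyContinuous ψ hψ) ?_ i1 i2
      (hu.equation ψ hψ)
    refine intervalIntegral.integral_zero_ae (ae_of_all _ fun x hx => ?_)
    by_cases hx1 : x ∈ Ioo (0 : ℝ) 1
    · rw [hu.initial x hx1, zero_mul]
    · rw [hψ.eq_zero hx1, mul_zero]
  · refine tendsto_laplaceTransform ?_ hg hu.left hz
    filter_upwards [Ioc_mem_nhdsGT (zero_lt_one' ℝ)] with y hy
    exact hu.continuousIntoL2.1 y hy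
  · have : laplaceTransform (u 1) z = laplaceTransform (fun _ => 0) z :=
      laplaceTransform_congr_ae
        ((ae_restrict_iff' measurableSet_Ioi).2 (ae_of_all _ fun t ht => hu.right t ht)) z
    rw [this]
    simp [laplaceTransform]

end IsWeakSolution

/-! ### Uniqueness of the weight -/

/-- If an observation is, after the Laplace transform, a fixed nonzero multiple of `Φ (√symbol)`
with `Φ` strictly decreasing for large arguments, then equal observations force equal weights. -/
theorem eqOn_of_strictAntiOn_sqrt_distSymbol {μ₁ μ₂ : ℝ → ℝ} (h₁ : ContinuousOn μ₁ (Icc 0 1))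
    (h₂ : ContinuousOn μ₂ (Icc 0 1)) (ht₁ : Tendsto (distSymbol μ₁) atTop atTop)
    (ht₂ : Tendsto (distSymbol μ₂) atTop atTop) {Φ : ℝ → ℝ} {K : ℝ} (hΦ : StrictAntiOn Φ (Ici K))
    (h : ∀ z > 0, 0 < distSymbol μ₁ z → 0 < distSymbol μ₂ z →
      Φ √(distSymbol μ₁ z) = Φ √(distSymbol μ₂ z)) :
    EqOn μ₁ μ₂ (Icc 0 1) := by
  have hev : ∀ᶠ z in atTop, distSymbol μ₁ z = distSymbol μ₂ z := by
    filter_upwards [ht₁.eventually_gt_atTop 0, ht₂.eventually_gt_atTop 0,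
      (Real.tendsto_sqrt_atTop.comp ht₁).eventually_ge_atTop K,
      (Real.tendsto_sqrt_atTop.comp ht₂).eventually_ge_atTop K,
      eventually_gt_atTop 0] with z p₁ p₂ k₁ k₂ hz
    exact (Real.sqrt_inj p₁.le p₂.le).1 (hΦ.injOn k₁ k₂ (h z hz p₁ p₂))
  obtain ⟨Z, hZ⟩ := eventually_atTop.1 hev
  exact eqOn_of_distSymbol_eq h₁ h₂ hZ

theorem mainTheorem3 (C b₀ b₁ : ℝ) (hC : 0 < C) (hb₀ : 0 ≤ b₀) (hb : b₀ < b₁) (hb₁ : b₁ ≤ 1)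
    (μ₁ μ₂ : ℝ → ℝ) (hμ₁ : μ₁ ∈ admissibleClass C b₀ b₁) (hμ₂ : μ₂ ∈ admissibleClass C b₀ b₁)
    (g : ℝ → ℝ) (hg : MemLp g 2 timeMeasure) (hLg : ∀ z > 0, laplaceTransform g z ≠ 0)
    (u₁ u₂ : ℝ → ℝ → ℝ) (hu₁ : IsWeakSolution μ₁ g u₁) (hu₂ : IsWeakSolution μ₂ g u₂)
    (x₀ : ℝ) (hx₀ : x₀ ∈ Ioo (0 : ℝ) 1) (xs : ℝ) (hxs : xs ∈ Ioc (0 : ℝ) 1)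
    (hdata : (∀ t > 0, u₁ x₀ t = u₂ x₀ t) ∨ (∀ t > 0, flux u₁ xs t = flux u₂ xs t)) :
    EqOn μ₁ μ₂ (Icc 0 1) := by
  have hc₁ := hμ₁.1.continuousOn
  have hc₂ := hμ₂.1.continuousOn
  have ht₁ := tendsto_distSymbol_atTop hC hb₀ hb hb₁ hμ₁
  have ht₂ := tendsto_distSymbol_atTop hC hb₀ hb hb₁ hμ₂
  have hL : ∀ f₁ f₂ : ℝ → ℝ, (∀ t > 0, f₁ t = f₂ t) → ∀ z,
      laplaceTransform f₁ z = laplaceTransform f₂ z := fun f₁ f₂ h z =>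
    laplaceTransform_congr_ae ((ae_restrict_iff' measurableSet_Ioi).2 (ae_of_all _ h)) z
  rcases hdata with h | h
  · obtain ⟨K, hK⟩ := exists_strictAntiOn_sinh_div_sinh (y := 1 - x₀)
      ⟨by linarith [hx₀.2], by linarith [hx₀.1]⟩
    refine eqOn_of_strictAntiOn_sqrt_distSymbol hc₁ hc₂ ht₁ ht₂ hK fun z hz p₁ p₂ => ?_
    have e := hL _ _ h z
    rw [(hu₁.laplaceTransform_eq hc₁ hμ₁.2.1 hg hz p₁ (Ioo_subset_Ioc_self hx₀)).1,
      (hu₂.laplaceTransform_eq hc₂ hμ₂.2.1 hg hz p₂ (Ioo_subset_Ioc_self hx₀)).1] at e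
    exact mul_left_cancel₀ (hLg z hz) e
  · obtain ⟨K, hK⟩ := exists_strictAntiOn_mul_cosh_div_sinh (y := 1 - xs)
      ⟨by linarith [hxs.2], by linarith [hxs.1]⟩
    refine eqOn_of_strictAntiOn_sqrt_distSymbol hc₁ hc₂ ht₁ ht₂ hK fun z hz p₁ p₂ => ?_
    have e := hL _ _ h z
    rw [(hu₁.laplaceTransform_eq hc₁ hμ₁.2.1 hg hz p₁ hxs).2,
      (hu₂.laplaceTransform_eq hc₂ hμ₂.2.1 hg hz p₂ hxs).2] at e
    exact mul_left_cancel₀ (hLg z hz) (neg_injective e)
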